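/- For real $a>-1$ and $b,z\in\mathbb{C}$ let $$W(a,b\,|\,z)=\sum_{k=0}^{\infty}\frac{z^k}{k!\,\Gamma(ak+b)}$$ be the Wright function (with $1/\Gamma$ read as $0$ at the poles of $\Gamma$). Put $\varepsilon=\max\bigl(|az|^{1/(a+1)},1\bigr)$ and $$I_r(\rho)=\frac1\pi\int_\rho^\infty \frac{\sin\!\bigl(\frac{\sin(\pi a)z}{r^a}+\pi b\bigr)}{r^b}\,e^{\frac{\cos(\pi a)z}{r^a}-r}\,dr,$$ $$I_u(\rho)=\frac1{\pi a}\int_\rho^\infty u^{\frac{1-b}{a}-1}\,\sin\!\Bigl(\frac{\sin(\pi a)z}{u}+\pi b\Bigr)\,e^{\frac{\cos(\pi a)z}{u}-u^{1/a}}\,du\qquad(a>0),$$ $$P(\rho)=\frac{\rho^{1-b}}{2\pi}\int_{-\pi}^{\pi}e^{\rho\cos\varphi+\cos(a\varphi)z/\rho^a}\cos\!\Bigl(\rho\sin\varphi-\frac{z\sin(a\varphi)}{\rho^a}+(1-b)\varphi\Bigr)\,d\varphi .$$ Theorem. The series converges absolutely, and the integrals that occur below converge absolutely, with: 1. if $a<0$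 and $\operatorname{Re} b<1$ (for real $b$: $b<1$), then $W(a,b\,|\,z)=I_r(0)$; 2. if $a<0$ and $b=1$, then $W(a,b\,|\,z)=I_r(0)+1$; 3. if $a<0$ and $\operatorname{Re} b>1$ (for real $b$: $b>1$), then $W(a,b\,|\,z)=I_r(\varepsilon)+P(\varepsilon)$; 4. if $a=0$, then $W(a,b\,|\,z)=e^z/\Gamma(b)$; 5. if $a>0$, then $W(a,b\,|\,z)=I_u(\varepsilon^a)+P(\varepsilon)$. -/

import Mathlib

noncomputable section

/-- The `k`-th term `z ^ k / (k! Γ(a k + b))` of the Wright series. `Complex.Gamma` vanishes at the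
poles of `Γ`, so the term is `0` there, in accordance with the entire function `1 / Γ`. -/
def wrightTerm (a : ℝ) (b z : ℂ) (k : ℕ) : ℂ :=
  z ^ k / ((k.factorial : ℂ) * Complex.Gamma ((a : ℂ) * (k : ℂ) + b))

/-- The Wright function `W(a, b | z)`. -/
def wright (a : ℝ) (b z : ℂ) : ℂ := ∑' k : ℕ, wrightTerm a b z k

/-- The integrand of `I_r`. -/
def radialIntegrand (a : ℝ) (b z : ℂ) (r : ℝ) : ℂ :=
  Complex.sin ((Real.sin (Real.pi * a) : ℂ) * z / ((r ^ a : ℝ) : ℂ) + (Real.pi : ℂ) * b)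
      / (r : ℂ) ^ b
    * Complex.exp ((Real.cos (Real.pi * a) : ℂ) * z / ((r ^ a : ℝ) : ℂ) - (r : ℂ))

/-- The radial integral `I_r(ε)`. -/
def radialIntegral (a : ℝ) (b z : ℂ) (ε : ℝ) : ℂ :=
  1 / (Real.pi : ℂ) * ∫ r in Set.Ioi ε, radialIntegrand a b z r

/-- The integrand of `I_u`. -/
def substIntegrand (a : ℝ) (b z : ℂ) (u : ℝ) : ℂ :=
  (u : ℂ) ^ ((1 - b) / (a : ℂ) - 1)
    * Complex.sin ((Real.sin (Real.pi * a) : ℂ) * z / (u : ℂ) + (Real.pi : ℂ) * b)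
    * Complex.exp ((Real.cos (Real.pi * a) : ℂ) * z / (u : ℂ) - ((u ^ (1 / a) : ℝ) : ℂ))

/-- The radial integral `I_u(ε)` in the variable `u = r ^ a`. -/
def substIntegral (a : ℝ) (b z : ℂ) (ε : ℝ) : ℂ :=
  1 / ((Real.pi : ℂ) * (a : ℂ)) * ∫ u in Set.Ioi ε, substIntegrand a b z u

/-- The integrand of `P(ε)`. -/
def arcIntegrand (a : ℝ) (b z : ℂ) (ε φ : ℝ) : ℂ :=
  Complex.exp (((ε * Real.cos φ : ℝ) : ℂ)
      + (Real.cos (a * φ) : ℂ) * z / ((ε ^ a : ℝ) : ℂ))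
    * Complex.cos (((ε * Real.sin φ : ℝ) : ℂ)
      - z * (Real.sin (a * φ) : ℂ) / ((ε ^ a : ℝ) : ℂ) + (1 - b) * (φ : ℂ))

/-- The circular integral `P(ε)`. -/
def arcIntegral (a : ℝ) (b z : ℂ) (ε : ℝ) : ℂ :=
  (ε : ℂ) ^ (1 - b) / (2 * (Real.pi : ℂ)) * ∫ φ in (-Real.pi)..Real.pi, arcIntegrand a b z ε φ

/-- The radius `ε = max(|a z| ^ (1 / (a + 1)), 1)`. -/
def wrightRadius (a : ℝ) (z : ℂ) : ℝ := max (‖(a : ℂ) * z‖ ^ (1 / (a + 1))) 1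

end

open MeasureTheory Filter Topology Set

/-! Everything rests on Hankel's formula for `1 / Γ`, with the contour made of a circle of radius
`ρ` and the two sides of the negative axis (`hankel_eq_inv_Gamma`). Insert it with `s = a k + b`
into each term of the series and sum under the integral sign: the sums over `k` are exponential
series and produce the two integrands (`hasSum_wrightTerm`). Since `-a < 1`, the majorant `exp (‖z‖
r ^ (-a))` is beaten by `exp (-r)`, so dominated convergence applies. Hankel's formula holds for
every `ρ > 0`, and the radius `ε` is one choice.

For `a < 0` and `Re b < 1` every `a k + b` has real part below `1`, so the circle can be shrunk away
and only the ray from `0` remains. For `b = 1` this fails only at `k = 0`, whose term is the extra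
`1`. For `a > 0` the ray is rewritten in `u = r ^ a`. -/

/-! ### Integrability on rays. -/

/-- The exponent `c r ^ p + σ log r` is `o(r)`, hence eventually at most `r / 2`, which leaves `exp
(-r / 2)`. -/
theorem integrableOn_exp_rpow_mul_rpow_mul_exp_neg {p : ℝ} (hp : p < 1) (c σ : ℝ) {ρ : ℝ}
    (hρ : 0 < ρ) :
    IntegrableOn (fun r : ℝ => Real.exp (c * r ^ p) * r ^ σ * Real.exp (-r)) (Ioi ρ) := by
  refine integrable_of_isBigO_exp_neg (b := 1 / 2) (by norm_num) ?_ ?_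
  · have h : ∀ x ∈ Ici ρ, x ≠ 0 := fun x hx => (hρ.trans_le hx).ne'
    refine ContinuousOn.mul (ContinuousOn.mul ?_ ?_) (by fun_prop)
    · exact Real.continuous_exp.comp_continuousOn
        (continuousOn_const.mul (continuousOn_id.rpow_const fun x hx => Or.inl (h x hx)))
    · exact continuousOn_id.rpow_const fun x hx => Or.inl (h x hx)
  · have h1 : (fun r : ℝ => c * r ^ p) =o[atTop] fun r : ℝ => r := by
      refine Asymptotics.IsLittleO.const_mul_left ?_ c
      refine (Asymptotics.isLittleO_iff_tendsto' ?_).2 ?_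
      · filter_upwards [eventually_gt_atTop 0] with r hr h
        exact absurd h hr.ne'
      · refine (tendsto_rpow_neg_atTop (y := 1 - p) (by linarith)).congr' ?_
        filter_upwards [eventually_gt_atTop 0] with r hr
        rw [neg_sub, Real.rpow_sub_one hr.ne']
    have h2 : (fun r : ℝ => σ * Real.log r) =o[atTop] fun r : ℝ => r :=
      Real.isLittleO_log_id_atTop.const_mul_left σ
    have h3 := (h1.add h2).def (c := 1 / 2) (by norm_num)
    refine Asymptotics.IsBigO.of_bound 1 ?_
    filter_upwards [h3, eventually_gt_atTop 0] with r hr hr0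
    rw [Real.norm_eq_abs, Real.norm_eq_abs, abs_of_pos hr0] at hr
    rw [Real.norm_of_nonneg (by positivity), Real.norm_of_nonneg (by positivity), one_mul,
      Real.rpow_def_of_pos hr0 σ, ← Real.exp_add, ← Real.exp_add, Real.exp_le_exp]
    have := (abs_le.1 hr).2
    linarith [mul_comm σ (Real.log r)]

theorem continuousOn_cpow_mul_exp_neg (s : ℂ) :
    ContinuousOn (fun r : ℝ => (r : ℂ) ^ s * Complex.exp (-(r : ℂ))) (Ioi 0) := by
  refine ContinuousOn.mul (fun r hr => ContinuousAt.continuousWithinAt ?_) (by fun_prop)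
  exact (Complex.continuousAt_ofReal_cpow_const r s (Or.inr (ne_of_gt hr)))

theorem norm_cpow_mul_exp_neg (s : ℂ) {r : ℝ} (hr : 0 < r) :
    ‖(r : ℂ) ^ s * Complex.exp (-(r : ℂ))‖ = r ^ s.re * Real.exp (-r) := by
  rw [norm_mul, Complex.norm_cpow_eq_rpow_re_of_pos hr, Complex.norm_exp]
  simp

theorem integrableOn_cpow_mul_exp_neg (s : ℂ) {ρ : ℝ} (hρ : 0 < ρ) :
    IntegrableOn (fun r : ℝ => (r : ℂ) ^ s * Complex.exp (-(r : ℂ))) (Ioi ρ) := by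
  refine (integrableOn_exp_rpow_mul_rpow_mul_exp_neg zero_lt_one 0 s.re hρ).mono'
    (((continuousOn_cpow_mul_exp_neg s).mono (Ioi_subset_Ioi hρ.le)).aestronglyMeasurable
      measurableSet_Ioi) ?_
  filter_upwards [ae_restrict_mem measurableSet_Ioi] with r hr
  rw [norm_cpow_mul_exp_neg s (hρ.trans hr)]
  simp

theorem integrableOn_cpow_mul_exp_neg_of_re {s : ℂ} (hs : s.re < 1) :
    IntegrableOn (fun r : ℝ => (r : ℂ) ^ (-s) * Complex.exp (-(r : ℂ))) (Ioi 0) := by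
  have := Complex.GammaIntegral_convergent (s := 1 - s) (by simpa using hs)
  refine this.congr_fun (fun r _ => ?_) measurableSet_Ioi
  simp [mul_comm]

theorem integral_cpow_mul_exp_neg_of_re {s : ℂ} (hs : s.re < 1) :
    ∫ r in Ioi (0 : ℝ), (r : ℂ) ^ (-s) * Complex.exp (-(r : ℂ)) = Complex.Gamma (1 - s) := by
  rw [Complex.Gamma_eq_integral (by simpa using hs), Complex.GammaIntegral]
  refine setIntegral_congr_fun measurableSet_Ioi (fun r _ => ?_)
  simp [mul_comm]

/-! ### Hankel's formula for real part below one. -/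

theorem inv_Gamma_eq_sin_mul_Gamma (s : ℂ) (hs : s.re < 1) :
    (Complex.Gamma s)⁻¹ = Complex.sin (Real.pi * s) / Real.pi * Complex.Gamma (1 - s) := by
  have h := Complex.Gamma_mul_Gamma_one_sub s
  have hne : Complex.Gamma (1 - s) ≠ 0 := Complex.Gamma_ne_zero_of_re_pos (by simpa using hs)
  have hpi : (Real.pi : ℂ) ≠ 0 := by exact_mod_cast Real.pi_ne_zero
  -- At a pole `Complex.Gamma` is `0`, and the reflection formula then forces the sine to vanish as
  -- well.
  by_cases hG : Complex.Gamma s = 0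
  · rw [hG, zero_mul] at h
    have : Complex.sin (Real.pi * s) = 0 := by
      by_contra h0
      exact div_ne_zero hpi h0 h.symm
    simp [hG, this]
  · have h0 : Complex.sin (Real.pi * s) ≠ 0 := by
      intro h0
      rw [h0, div_zero] at h
      exact mul_ne_zero hG hne h
    field_simp
    rw [eq_div_iff h0] at h
    linear_combination -h

/-- The integral over the circle of radius `ρ` in Hankel's formula, up to the factor
`ρ ^ (1 - s) / 2π`. -/
noncomputable def hankelArc (ρ : ℝ) (s : ℂ) : ℂ :=
  ∫ φ in (-Real.pi)..Real.pi,
    Complex.exp (ρ * Complex.exp (φ * Complex.I) + (1 - s) * (φ * Complex.I))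

/-- The right-hand side of Hankel's formula. -/
noncomputable def hankel (ρ : ℝ) (s : ℂ) : ℂ :=
  Complex.sin (Real.pi * s) / Real.pi *
      (∫ r in Ioi ρ, (r : ℂ) ^ (-s) * Complex.exp (-(r : ℂ))) +
    (ρ : ℂ) ^ (1 - s) / (2 * Real.pi) * hankelArc ρ s

/-- In the coordinate `w = log t` the circle becomes the vertical segment over `log ρ`, and the
integrand extends to an entire function of `w`, with no branch cut. -/
theorem cpow_mul_hankelArc {ρ : ℝ} (hρ : 0 < ρ) (s : ℂ) :
    (ρ : ℂ) ^ (1 - s) * hankelArc ρ s = ∫ φ in (-Real.pi)..Real.pi,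
      Complex.exp (Complex.exp (Real.log ρ + φ * Complex.I)
        + (1 - s) * (Real.log ρ + φ * Complex.I)) := by
  have hρ' : (ρ : ℂ) ≠ 0 := by exact_mod_cast hρ.ne'
  rw [hankelArc, ← intervalIntegral.integral_const_mul]
  congr 1 with φ
  rw [Complex.cpow_def_of_ne_zero hρ', ← Complex.exp_add, Complex.exp_add (Real.log ρ : ℂ),
    ← Complex.ofReal_exp, Real.exp_log hρ, Complex.ofReal_log hρ.le]
  congr 1
  ring

theorem integral_log_log_eq {δ ρ : ℝ} (hδ : 0 < δ) (hρ : 0 < ρ) (s : ℂ) :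
    ∫ x in Real.log δ..Real.log ρ, Complex.exp (-Complex.exp x + (1 - s) * x) =
      ∫ r in δ..ρ, (r : ℂ) ^ (-s) * Complex.exp (-(r : ℂ)) := by
  have h := intervalIntegral.integral_deriv_smul_comp' (a := Real.log δ) (b := Real.log ρ)
    (f := Real.exp) (f' := Real.exp)
    (g := fun r : ℝ => (r : ℂ) ^ (-s) * Complex.exp (-(r : ℂ)))
    (fun x _ => Real.hasDerivAt_exp x) Real.continuous_exp.continuousOn
    ((continuousOn_cpow_mul_exp_neg (-s)).mono (by rintro _ ⟨x, -, rfl⟩; exact Real.exp_pos x))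
  rw [Real.exp_log hδ, Real.exp_log hρ] at h
  rw [← h]
  congr 1 with x
  have hx : (Real.exp x : ℂ) ≠ 0 := by exact_mod_cast (Real.exp_pos x).ne'
  rw [Function.comp_apply, Complex.real_smul, Complex.cpow_def_of_ne_zero hx,
    ← Complex.ofReal_log (Real.exp_pos x).le, Real.log_exp, Complex.ofReal_exp,
    ← Complex.exp_add, ← Complex.exp_add]
  congr 1
  ring

/-- Cauchy's theorem on the rectangle `[log δ, log ρ] × [-π, π]`. The horizontal sides carry the
same integral with phases `exp (±iπ(1 - s))`, whose difference is `2i sin (π s)`. -/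
theorem hankelArc_sub {δ ρ : ℝ} (hδ : 0 < δ) (hρ : 0 < ρ) (s : ℂ) :
    (ρ : ℂ) ^ (1 - s) * hankelArc ρ s - (δ : ℂ) ^ (1 - s) * hankelArc δ s =
      2 * Complex.sin (Real.pi * s) *
        ∫ r in δ..ρ, (r : ℂ) ^ (-s) * Complex.exp (-(r : ℂ)) := by
  have h := Complex.integral_boundary_rect_eq_zero_of_differentiableOn
    (fun w => Complex.exp (Complex.exp w + (1 - s) * w))
    (⟨Real.log δ, -Real.pi⟩) (⟨Real.log ρ, Real.pi⟩)
    (by fun_prop)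
  have e1 : ∀ x : ℝ, Complex.exp (Complex.exp (x + ((-Real.pi : ℝ) : ℂ) * Complex.I)
      + (1 - s) * (x + ((-Real.pi : ℝ) : ℂ) * Complex.I)) =
      Complex.exp (-((1 - s) * (Real.pi * Complex.I))) *
        Complex.exp (-Complex.exp x + (1 - s) * x) := by
    intro x
    rw [← Complex.exp_add, Complex.exp_add (x : ℂ)]
    congr 1
    push_cast
    rw [neg_mul, Complex.exp_neg (Real.pi * Complex.I), Complex.exp_pi_mul_I]
    ring
  have e2 : ∀ x : ℝ, Complex.exp (Complex.exp (x + ((Real.pi : ℝ) : ℂ) * Complex.I)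
      + (1 - s) * (x + ((Real.pi : ℝ) : ℂ) * Complex.I)) =
      Complex.exp ((1 - s) * (Real.pi * Complex.I)) *
        Complex.exp (-Complex.exp x + (1 - s) * x) := by
    intro x
    rw [← Complex.exp_add, Complex.exp_add (x : ℂ), Complex.exp_pi_mul_I]
    congr 1
    ring
  simp only [e1, e2, intervalIntegral.integral_const_mul, smul_eq_mul] at h
  rw [integral_log_log_eq hδ hρ, ← cpow_mul_hankelArc hδ, ← cpow_mul_hankelArc hρ] at h
  have hs : Complex.exp ((1 - s) * (Real.pi * Complex.I)) -
      Complex.exp (-((1 - s) * (Real.pi * Complex.I))) =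
      2 * Complex.I * Complex.sin (Real.pi * s) := by
    have : Complex.sin (Real.pi * s) = Complex.sin (Real.pi * (1 - s)) := by
      rw [mul_sub, mul_one, Complex.sin_pi_sub]
    rw [this, Complex.sin, show -(Real.pi * (1 - s)) * Complex.I
      = -((1 - s) * (Real.pi * Complex.I)) by ring,
      show (Real.pi * (1 - s) * Complex.I) = ((1 - s) * (Real.pi * Complex.I)) by ring]
    linear_combination (Complex.exp ((1 - s) * (Real.pi * Complex.I)) -
      Complex.exp (-((1 - s) * (Real.pi * Complex.I)))) * Complex.I_sq
  have hI : Complex.I ≠ 0 := Complex.I_ne_zero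
  refine mul_left_cancel₀ hI ?_
  linear_combination h + (∫ r in δ..ρ, (r : ℂ) ^ (-s) * Complex.exp (-(r : ℂ))) * hs

theorem norm_hankelArc_le {ρ : ℝ} (hρ : 0 < ρ) (hρ1 : ρ ≤ 1) (s : ℂ) :
    ‖hankelArc ρ s‖ ≤ Real.exp (1 + |s.im| * Real.pi) * |Real.pi - -Real.pi| := by
  refine intervalIntegral.norm_integral_le_of_norm_le_const fun φ hφ => ?_
  rw [uIoc_of_le (by linarith [Real.pi_pos])] at hφ
  rw [Complex.norm_exp, Real.exp_le_exp]
  have h1 : (ρ * Complex.exp (φ * Complex.I)).re ≤ 1 := by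
    rw [Complex.exp_mul_I, ← Complex.ofReal_cos, ← Complex.ofReal_sin]
    have : (ρ * ((Real.cos φ : ℂ) + Real.sin φ * Complex.I)).re = ρ * Real.cos φ := by
      simp only [Complex.re_ofReal_mul, Complex.add_re, Complex.ofReal_re, Complex.mul_I_re,
        Complex.ofReal_im, neg_zero, add_zero]
    rw [this]
    nlinarith [Real.cos_le_one φ]
  have h2 : ((1 - s) * (φ * Complex.I)).re ≤ |s.im| * Real.pi := by
    have : ((1 - s) * (φ * Complex.I)).re = s.im * φ := by simp
    rw [this]
    refine (le_abs_self _).trans ?_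
    rw [abs_mul]
    exact mul_le_mul_of_nonneg_left (abs_le.2 ⟨hφ.1.le, hφ.2⟩) (abs_nonneg _)
  simpa using add_le_add h1 h2

theorem tendsto_cpow_mul_hankelArc {s : ℂ} (hs : s.re < 1) :
    Tendsto (fun δ : ℝ => (δ : ℂ) ^ (1 - s) * hankelArc δ s) (𝓝[>] 0) (𝓝 0) := by
  refine squeeze_zero_norm'
    (a := fun δ : ℝ => δ ^ (1 - s.re) * (Real.exp (1 + |s.im| * Real.pi) * |Real.pi - -Real.pi|))
    ?_ ?_
  · filter_upwards [Ioc_mem_nhdsGT zero_lt_one] with δ hδ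
    rw [norm_mul, Complex.norm_cpow_eq_rpow_re_of_pos hδ.1]
    have := norm_hankelArc_le hδ.1 hδ.2 s
    simpa using mul_le_mul_of_nonneg_left this (Real.rpow_nonneg hδ.1.le (1 - s.re))
  · have h : Tendsto (fun δ : ℝ => δ ^ (1 - s.re)) (𝓝[>] 0) (𝓝 0) := by
      have := (Real.continuousAt_rpow_const 0 (1 - s.re) (Or.inr (by linarith))).tendsto
      rw [Real.zero_rpow (by linarith)] at this
      exact this.mono_left nhdsWithin_le_nhds
    simpa using h.mul_const (Real.exp (1 + |s.im| * Real.pi) * |Real.pi - -Real.pi|)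

theorem cpow_mul_hankelArc_eq_integral {ρ : ℝ} (hρ : 0 < ρ) {s : ℂ} (hs : s.re < 1) :
    (ρ : ℂ) ^ (1 - s) * hankelArc ρ s = 2 * Complex.sin (Real.pi * s) *
      ∫ r in (0 : ℝ)..ρ, (r : ℂ) ^ (-s) * Complex.exp (-(r : ℂ)) := by
  have hint : IntegrableOn (fun r : ℝ => (r : ℂ) ^ (-s) * Complex.exp (-(r : ℂ))) (uIcc 0 ρ) := by
    rw [uIcc_of_le hρ.le, integrableOn_Icc_iff_integrableOn_Ioc]
    exact (integrableOn_cpow_mul_exp_neg_of_re hs).mono_set Ioc_subset_Ioi_self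
  have hc := intervalIntegral.continuousOn_primitive_interval_left hint 0 left_mem_uIcc
  have hc' : Tendsto (fun δ : ℝ => ∫ r in δ..ρ, (r : ℂ) ^ (-s) * Complex.exp (-(r : ℂ)))
      (𝓝[>] 0) (𝓝 (∫ r in (0 : ℝ)..ρ, (r : ℂ) ^ (-s) * Complex.exp (-(r : ℂ)))) := by
    refine hc.tendsto.mono_left ?_
    rw [uIcc_of_le hρ.le]
    exact nhdsWithin_le_of_mem (mem_of_superset (Ioc_mem_nhdsGT hρ) Ioc_subset_Icc_self)
  have h1 := (tendsto_cpow_mul_hankelArc hs).const_sub ((ρ : ℂ) ^ (1 - s) * hankelArc ρ s)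
  have h2 := hc'.const_mul (2 * Complex.sin (Real.pi * s))
  rw [sub_zero] at h1
  refine tendsto_nhds_unique h1 (h2.congr' ?_)
  filter_upwards [self_mem_nhdsWithin] with δ hδ
  exact (hankelArc_sub hδ hρ s).symm

/-- The circle contributes exactly the missing piece of the ray from `0` to `ρ`, completing it to
the integral of `Γ (1 - s)`; reflection finishes. -/
theorem hankel_eq_of_re {ρ : ℝ} (hρ : 0 < ρ) {s : ℂ} (hs : s.re < 1) :
    hankel ρ s = (Complex.Gamma s)⁻¹ := by
  have hint := integrableOn_cpow_mul_exp_neg_of_re hs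
  have hsplit : (∫ r in (0 : ℝ)..ρ, (r : ℂ) ^ (-s) * Complex.exp (-(r : ℂ))) +
      ∫ r in Ioi ρ, (r : ℂ) ^ (-s) * Complex.exp (-(r : ℂ)) = Complex.Gamma (1 - s) := by
    rw [← integral_cpow_mul_exp_neg_of_re hs]
    exact intervalIntegral.integral_interval_add_Ioi hint
      (hint.mono_set (Ioi_subset_Ioi hρ.le))
  have hpi : (Real.pi : ℂ) ≠ 0 := by exact_mod_cast Real.pi_ne_zero
  rw [hankel, div_mul_eq_mul_div ((ρ : ℂ) ^ (1 - s)), cpow_mul_hankelArc_eq_integral hρ hs,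
    inv_Gamma_eq_sin_mul_Gamma s hs, ← hsplit]
  field_simp
  ring

/-! ### Extension of Hankel's formula to all arguments. -/

/-- The sine kills the ray, and the circle gives the mean value of `exp`. This point is separate
because the recurrence from `0` to `1` has factor `0`. -/
theorem hankel_one (ρ : ℝ) : hankel ρ 1 = 1 := by
  have hpi : (Real.pi : ℂ) ≠ 0 := by exact_mod_cast Real.pi_ne_zero
  have h1 : hankelArc ρ 1 = ∫ φ in (0 : ℝ)..2 * Real.pi, Complex.exp (circleMap 0 ρ φ) := by
    have hper : Function.Periodic (fun φ : ℝ => Complex.exp (circleMap 0 ρ φ)) (2 * Real.pi) :=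
      fun φ => by simp only [periodic_circleMap 0 ρ φ]
    have := hper.intervalIntegral_add_eq (-Real.pi) 0
    rw [show -Real.pi + 2 * Real.pi = Real.pi by ring, zero_add] at this
    rw [← this, hankelArc]
    congr 1 with φ
    simp [circleMap]
  have h2 : Real.circleAverage Complex.exp 0 ρ = 1 := by
    rw [DiffContOnCl.circleAverage (f := Complex.exp) (c := 0) (R := ρ)
      (Complex.differentiable_exp.diffContOnCl), Complex.exp_zero]
  rw [Real.circleAverage, ← h1, Complex.real_smul] at h2
  rw [hankel]
  simp only [mul_one, Complex.sin_pi, sub_self, Complex.cpow_zero, zero_div, zero_mul, zero_add]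
  push_cast at h2
  rw [one_div]
  exact h2

theorem hankel_radial_by_parts {ρ : ℝ} (hρ : 0 < ρ) (s : ℂ) :
    ∫ r in Ioi ρ, (r : ℂ) ^ (-s) * Complex.exp (-(r : ℂ)) =
      (ρ : ℂ) ^ (-s) * Complex.exp (-(ρ : ℂ)) -
        s * ∫ r in Ioi ρ, (r : ℂ) ^ (-(s + 1)) * Complex.exp (-(r : ℂ)) := by
  have hd : ∀ r : ℝ, 0 < r → HasDerivAt (fun r : ℝ => (r : ℂ) ^ (-s) * Complex.exp (-(r : ℂ)))
      (-s * ((r : ℂ) ^ (-(s + 1)) * Complex.exp (-(r : ℂ))) -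
        (r : ℂ) ^ (-s) * Complex.exp (-(r : ℂ))) r := by
    intro r hr
    have h1 : HasDerivAt (fun w : ℂ => w ^ (-s) * Complex.exp (-w))
        (-s * (r : ℂ) ^ (-s - 1) * 1 * Complex.exp (-(r : ℂ)) +
          (r : ℂ) ^ (-s) * (Complex.exp (-(r : ℂ)) * -1)) (r : ℂ) :=
      ((hasDerivAt_id (r : ℂ)).cpow_const (Or.inl hr)).mul
        ((hasDerivAt_neg (r : ℂ)).cexp)
    convert h1.comp_ofReal using 1
    rw [show -(s + 1) = -s - 1 by ring]
    ring
  have hi1 := integrableOn_cpow_mul_exp_neg (-s) hρ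
  have hi2 := (integrableOn_cpow_mul_exp_neg (-(s + 1)) hρ).const_mul (-s)
  have hlim : Tendsto (fun r : ℝ => (r : ℂ) ^ (-s) * Complex.exp (-(r : ℂ))) atTop (𝓝 0) := by
    rw [tendsto_zero_iff_norm_tendsto_zero]
    refine (tendsto_rpow_mul_exp_neg_mul_atTop_nhds_zero (-s).re 1 one_pos).congr' ?_
    filter_upwards [eventually_gt_atTop 0] with r hr
    rw [norm_cpow_mul_exp_neg _ hr, neg_one_mul]
  have h := integral_Ioi_of_hasDerivAt_of_tendsto
    (hd ρ hρ).continuousAt.continuousWithinAt (fun r hr => hd r (hρ.trans hr)) (hi2.sub hi1) hlim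
  rw [integral_sub hi2 hi1, integral_const_mul] at h
  linear_combination -h

/-- Integrate the derivative of `exp (ρ exp (iφ) - s iφ)` over `[-π, π]`. The boundary values are
those that cancel the boundary term of the ray in `hankel_eq_mul_hankel_add_one`. -/
theorem hankelArc_by_parts (ρ : ℝ) (s : ℂ) :
    ρ * hankelArc ρ s - s * hankelArc ρ (s + 1) =
      -2 * Complex.sin (Real.pi * s) * Complex.exp (-(ρ : ℂ)) := by
  have hd : ∀ φ : ℝ, HasDerivAt
      (fun φ : ℝ => Complex.exp (ρ * Complex.exp (φ * Complex.I) - s * (φ * Complex.I)))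
      (Complex.I * (ρ * Complex.exp (ρ * Complex.exp (φ * Complex.I) + (1 - s) * (φ * Complex.I)))
        - Complex.I * (s * Complex.exp (ρ * Complex.exp (φ * Complex.I)
          + (1 - (s + 1)) * (φ * Complex.I)))) φ := by
    intro φ
    have h0 : HasDerivAt (fun w : ℂ => w * Complex.I) Complex.I (φ : ℂ) := by
      simpa using (hasDerivAt_id (φ : ℂ)).mul_const Complex.I
    have h1 := (((h0.cexp.const_mul (ρ : ℂ)).sub (h0.const_mul s)).cexp).comp_ofReal
    refine HasDerivAt.congr_deriv h1 ?_
    rw [show (ρ * Complex.exp (φ * Complex.I) + (1 - s) * (φ * Complex.I)) =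
      (ρ * Complex.exp (φ * Complex.I) - s * (φ * Complex.I)) + φ * Complex.I by ring,
      show (ρ * Complex.exp (φ * Complex.I) + (1 - (s + 1)) * (φ * Complex.I)) =
      (ρ * Complex.exp (φ * Complex.I) - s * (φ * Complex.I)) by ring, Complex.exp_add]
    simp only [Pi.sub_apply]
    ring
  have h := intervalIntegral.integral_eq_sub_of_hasDerivAt (a := -Real.pi) (b := Real.pi)
    (fun φ _ => hd φ) (Continuous.intervalIntegrable (by fun_prop) _ _)
  rw [intervalIntegral.integral_sub (Continuous.intervalIntegrable (by fun_prop) _ _)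
    (Continuous.intervalIntegrable (by fun_prop) _ _)] at h
  simp only [intervalIntegral.integral_const_mul] at h
  rw [← hankelArc, ← hankelArc] at h
  have e1 : Complex.exp (ρ * Complex.exp (Real.pi * Complex.I) - s * (Real.pi * Complex.I)) =
      Complex.exp (-(ρ : ℂ)) * Complex.exp (-(Real.pi * s) * Complex.I) := by
    rw [Complex.exp_pi_mul_I, ← Complex.exp_add]; congr 1; ring
  have e2 : Complex.exp (ρ * Complex.exp ((-Real.pi : ℝ) * Complex.I)
      - s * ((-Real.pi : ℝ) * Complex.I)) =
      Complex.exp (-(ρ : ℂ)) * Complex.exp ((Real.pi * s) * Complex.I) := by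
    push_cast
    rw [neg_mul, Complex.exp_neg (Real.pi * Complex.I), Complex.exp_pi_mul_I, ← Complex.exp_add]
    congr 1; ring
  rw [e1, e2] at h
  rw [Complex.sin]
  linear_combination -Complex.I * h + (ρ * hankelArc ρ s - s * hankelArc ρ (s + 1)) * Complex.I_sq

theorem hankel_eq_mul_hankel_add_one {ρ : ℝ} (hρ : 0 < ρ) (s : ℂ) :
    hankel ρ s = s * hankel ρ (s + 1) := by
  have hpi : (Real.pi : ℂ) ≠ 0 := by exact_mod_cast Real.pi_ne_zero
  have hρ' : (ρ : ℂ) ≠ 0 := by exact_mod_cast hρ.ne'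
  have hsin : Complex.sin (Real.pi * (s + 1)) = -Complex.sin (Real.pi * s) := by
    rw [mul_add, mul_one, Complex.sin_add_pi]
  have hA := hankelArc_by_parts ρ s
  have hpow : (ρ : ℂ) ^ (1 - s) = ρ * (ρ : ℂ) ^ (-s) := by
    rw [sub_eq_add_neg, Complex.cpow_add _ _ hρ', Complex.cpow_one]
  rw [hankel, hankel, hankel_radial_by_parts hρ s, hsin, hpow,
    show 1 - (s + 1) = -s by ring]
  field_simp
  linear_combination (ρ : ℂ) ^ (-s) * hA

/-- Hankel's formula for `1 / Γ`, along a circle of any radius and its two rays. -/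
theorem hankel_eq_inv_Gamma {ρ : ℝ} (hρ : 0 < ρ) (s : ℂ) :
    hankel ρ s = (Complex.Gamma s)⁻¹ := by
  -- Both sides satisfy `f s = s * f (s + 1)`, so the formula spreads to the right by strips of
  -- width one.
  suffices h : ∀ (n : ℕ) (s : ℂ), s.re < n + 1 → hankel ρ s = (Complex.Gamma s)⁻¹ by
    obtain ⟨n, hn⟩ := exists_nat_gt s.re
    exact h n s (by linarith)
  intro n
  induction n with
  | zero => exact fun s hs => hankel_eq_of_re hρ (by simpa using hs)
  | succ n ih =>
    intro s hs
    by_cases h1 : s = 1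
    · rw [h1, hankel_one ρ, Complex.Gamma_one, inv_one]
    · have h0 : s - 1 ≠ 0 := sub_ne_zero.2 h1
      have hr := hankel_eq_mul_hankel_add_one hρ (s - 1)
      have hG := Complex.Gamma_add_one (s - 1) h0
      rw [sub_add_cancel] at hr hG
      rw [ih (s - 1) (by push_cast at hs; simp; linarith)] at hr
      rw [hG, mul_inv, hr, inv_mul_cancel_left₀ h0]

/-! ### Termwise integration along the ray. -/

theorem integrableOn_Ioi_zero_exp_rpow_mul_rpow_mul_exp_neg {p : ℝ} (hp0 : 0 ≤ p) (hp : p < 1)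
    {c σ : ℝ} (hc : 0 ≤ c) (hσ : -1 < σ) :
    IntegrableOn (fun r : ℝ => Real.exp (c * r ^ p) * r ^ σ * Real.exp (-r)) (Ioi 0) := by
  rw [← Ioc_union_Ioi_eq_Ioi (zero_le_one (α := ℝ))]
  refine IntegrableOn.union ?_ (integrableOn_exp_rpow_mul_rpow_mul_exp_neg hp c σ one_pos)
  have h : IntegrableOn (fun r : ℝ => Real.exp c * r ^ σ) (Ioc 0 1) := by
    rw [← intervalIntegrable_iff_integrableOn_Ioc_of_le zero_le_one]
    exact (intervalIntegral.intervalIntegrable_rpow' hσ).const_mul _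
  refine h.mono' (Measurable.aestronglyMeasurable (by fun_prop)) ?_
  filter_upwards [ae_restrict_mem measurableSet_Ioc] with r hr
  have h0 : 0 < r := hr.1
  rw [Real.norm_of_nonneg (by positivity)]
  have h1 : Real.exp (c * r ^ p) ≤ Real.exp c :=
    Real.exp_le_exp.2 (mul_le_of_le_one_right hc (Real.rpow_le_one h0.le hr.2 hp0))
  have h2 : Real.exp (-r) ≤ 1 := Real.exp_le_one_iff.2 (by linarith)
  calc Real.exp (c * r ^ p) * r ^ σ * Real.exp (-r) ≤ Real.exp c * r ^ σ * 1 := by gcongr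
    _ = _ := mul_one _

theorem hasSum_pow_div_factorial (x : ℝ) :
    HasSum (fun k : ℕ => x ^ k / k.factorial) (Real.exp x) := by
  rw [Real.exp_eq_exp_ℝ]
  exact NormedSpace.expSeries_div_hasSum_exp x

theorem Complex.hasSum_pow_div_factorial (x : ℂ) :
    HasSum (fun k : ℕ => x ^ k / k.factorial) (Complex.exp x) := by
  rw [Complex.exp_eq_exp_ℂ]
  exact NormedSpace.expSeries_div_hasSum_exp x

theorem Complex.norm_sin_le_exp (w : ℂ) : ‖Complex.sin w‖ ≤ Real.exp |w.im| := by
  rw [Complex.sin, norm_div, norm_mul, Complex.norm_I, mul_one, Complex.norm_two]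
  have h1 : ‖Complex.exp (-w * Complex.I)‖ ≤ Real.exp |w.im| := by
    rw [Complex.norm_exp, Real.exp_le_exp]
    simpa using le_abs_self w.im
  have h2 : ‖Complex.exp (w * Complex.I)‖ ≤ Real.exp |w.im| := by
    rw [Complex.norm_exp, Real.exp_le_exp]
    simpa using neg_le_abs w.im
  have := norm_sub_le (Complex.exp (-w * Complex.I)) (Complex.exp (w * Complex.I))
  linarith

/-- Termwise integration over a ray for a series dominated by an exponential series in `r ^ p`. -/
theorem integrableOn_and_hasSum_integral_of_norm_le {F : ℕ → ℝ → ℂ} {f : ℝ → ℂ} {ρ c p σ : ℝ}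
    (C : ℝ) (hρ : 0 ≤ ρ) (hF : ∀ k, ContinuousOn (F k) (Ioi 0))
    (hle : ∀ k r, 0 < r →
      ‖F k r‖ ≤ C * ((c * r ^ p) ^ k / k.factorial * (r ^ σ * Real.exp (-r))))
    (hint : IntegrableOn (fun r : ℝ => Real.exp (c * r ^ p) * r ^ σ * Real.exp (-r)) (Ioi ρ))
    (hf : ∀ r, 0 < r → HasSum (fun k => F k r) (f r)) :
    IntegrableOn f (Ioi ρ) ∧ HasSum (fun k => ∫ r in Ioi ρ, F k r) (∫ r in Ioi ρ, f r) := by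
  have hpos : ∀ᵐ r ∂(volume.restrict (Ioi ρ)), 0 < r := by
    filter_upwards [ae_restrict_mem measurableSet_Ioi] with r hr using hρ.trans_lt hr
  have hb : ∀ r : ℝ, HasSum
      (fun k : ℕ => C * ((c * r ^ p) ^ k / k.factorial * (r ^ σ * Real.exp (-r))))
      (C * (Real.exp (c * r ^ p) * r ^ σ * Real.exp (-r))) := fun r => by
    rw [mul_assoc (Real.exp _)]
    exact ((hasSum_pow_div_factorial (c * r ^ p)).mul_right _).mul_left C
  have hm : ∀ k, AEStronglyMeasurable (F k) (volume.restrict (Ioi ρ)) := fun k =>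
    ((hF k).mono (Ioi_subset_Ioi hρ)).aestronglyMeasurable measurableSet_Ioi
  have hint' := hint.const_mul C
  constructor
  · refine hint'.mono' (aestronglyMeasurable_of_tendsto_ae atTop
      (f := fun (n : ℕ) r => ∑ k ∈ Finset.range n, F k r)
      (fun n => Finset.aestronglyMeasurable_fun_sum _ fun k _ => hm k) ?_) ?_
    · filter_upwards [hpos] with r hr using (hf r hr).tendsto_sum_nat
    · filter_upwards [hpos] with r hr
      rw [← (hf r hr).tsum_eq]
      exact tsum_of_norm_bounded (hb r) fun k => hle k r hr
  · refine hasSum_integral_of_dominated_convergence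
      (fun k r => C * ((c * r ^ p) ^ k / k.factorial * (r ^ σ * Real.exp (-r)))) hm
      (fun k => ?_) (Eventually.of_forall fun r => (hb r).summable) ?_ ?_
    · filter_upwards [hpos] with r hr using hle k r hr
    · simp_rw [(hb _).tsum_eq]
      exact hint'
    · filter_upwards [hpos] with r hr using hf r hr

/-- The `k`-th term of the expansion of the radial integrand in powers of `z`. -/
noncomputable def radialTerm (a : ℝ) (b z : ℂ) (k : ℕ) (r : ℝ) : ℂ :=
  z ^ k / k.factorial * Complex.sin (Real.pi * (a * k + b)) *
    ((r : ℂ) ^ (-((a : ℂ) * k + b)) * Complex.exp (-(r : ℂ)))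

theorem continuousOn_radialTerm (a : ℝ) (b z : ℂ) (k : ℕ) :
    ContinuousOn (radialTerm a b z k) (Ioi 0) :=
  continuousOn_const.mul (continuousOn_cpow_mul_exp_neg _)

theorem cpow_neg_mul_add (a : ℝ) (b : ℂ) (k : ℕ) {r : ℝ} (hr : 0 < r) :
    (r : ℂ) ^ (-((a : ℂ) * k + b)) = (((r ^ a : ℝ) : ℂ) ^ k)⁻¹ * ((r : ℂ) ^ b)⁻¹ := by
  have hr' : (r : ℂ) ≠ 0 := by exact_mod_cast hr.ne'
  rw [Complex.cpow_neg, Complex.cpow_add _ _ hr', mul_inv, mul_comm (a : ℂ), Complex.cpow_nat_mul,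
    ← Complex.ofReal_cpow hr.le]

/-- Splitting the sine into exponentials gives two exponential series, with arguments `z r ^ (-a)
exp (∓iπa)`. -/
theorem hasSum_radialTerm (a : ℝ) (b z : ℂ) {r : ℝ} (hr : 0 < r) :
    HasSum (fun k => radialTerm a b z k r) (radialIntegrand a b z r) := by
  set q : ℂ := z / ((r ^ a : ℝ) : ℂ) with hq
  have h1 := ((Complex.hasSum_pow_div_factorial
    (q * Complex.exp (-(Real.pi * a) * Complex.I))).mul_left
      (Complex.exp (-(Real.pi * b) * Complex.I)))
  have h2 := ((Complex.hasSum_pow_div_factorial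
    (q * Complex.exp (Real.pi * a * Complex.I))).mul_left
      (Complex.exp (Real.pi * b * Complex.I)))
  have h := (h1.sub h2).mul_right
    (Complex.I / 2 * (((r : ℂ) ^ b)⁻¹ * Complex.exp (-(r : ℂ))))
  convert! h using 1
  · funext k
    rw [radialTerm, cpow_neg_mul_add a b k hr, Complex.sin, mul_pow, mul_pow, ← Complex.exp_nat_mul,
      ← Complex.exp_nat_mul, hq, div_pow,
      show -((Real.pi : ℂ) * (a * k + b)) * Complex.I =
        -(Real.pi * b) * Complex.I + k * (-(Real.pi * a) * Complex.I) by ring,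
      show (Real.pi : ℂ) * (a * k + b) * Complex.I =
        Real.pi * b * Complex.I + k * (Real.pi * a * Complex.I) by ring,
      Complex.exp_add, Complex.exp_add]
    ring
  · have e1 : Complex.exp (-(Real.pi * a) * Complex.I) =
        (Real.cos (Real.pi * a) : ℂ) - (Real.sin (Real.pi * a) : ℂ) * Complex.I := by
      rw [Complex.exp_mul_I, Complex.cos_neg, Complex.sin_neg]
      push_cast
      ring
    have e2 : Complex.exp (Real.pi * a * Complex.I) =
        (Real.cos (Real.pi * a) : ℂ) + (Real.sin (Real.pi * a) : ℂ) * Complex.I := by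
      rw [Complex.exp_mul_I]
      push_cast
      ring
    rw [radialIntegrand, e1, e2, mul_div_assoc, mul_div_assoc, ← hq, Complex.sin]
    generalize (Real.cos (Real.pi * a) : ℂ) = c
    generalize (Real.sin (Real.pi * a) : ℂ) = d
    rw [← Complex.exp_add, ← Complex.exp_add,
      show -(Real.pi * b) * Complex.I + q * (c - d * Complex.I) =
        -(d * q + Real.pi * b) * Complex.I + c * q by ring,
      show Real.pi * b * Complex.I + q * (c + d * Complex.I) =
        (d * q + Real.pi * b) * Complex.I + c * q by ring,
      sub_eq_add_neg (c * q), Complex.exp_add (c * q), Complex.exp_add _ (c * q),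
      Complex.exp_add _ (c * q)]
    ring

/-- As `a k` is real, the argument of the sine has imaginary part `π Im b`, so the sine is bounded
uniformly in `k`. -/
theorem norm_radialTerm_le (a : ℝ) (b z : ℂ) (k : ℕ) {r : ℝ} (hr : 0 < r) :
    ‖radialTerm a b z k r‖ ≤ Real.exp (Real.pi * |b.im|) *
      ((‖z‖ * r ^ (-a)) ^ k / k.factorial * (r ^ (-b.re) * Real.exp (-r))) := by
  have h1 : ‖Complex.sin (Real.pi * (a * k + b))‖ ≤ Real.exp (Real.pi * |b.im|) := by
    refine (Complex.norm_sin_le_exp _).trans_eq ?_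
    congr 1
    rw [Complex.im_ofReal_mul, abs_mul, abs_of_pos Real.pi_pos]
    simp
  have h2 : r ^ (-((a : ℂ) * k + b)).re = (r ^ (-a)) ^ k * r ^ (-b.re) := by
    rw [← Real.rpow_mul_natCast hr.le, ← Real.rpow_add hr]
    congr 1
    simp
    ring
  rw [radialTerm, norm_mul, norm_mul, norm_cpow_mul_exp_neg _ hr, h2, norm_div, norm_pow,
    Complex.norm_natCast, mul_pow]
  calc _ ≤ ‖z‖ ^ k / k.factorial * Real.exp (Real.pi * |b.im|) *
      ((r ^ (-a)) ^ k * r ^ (-b.re) * Real.exp (-r)) := by gcongr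
    _ = _ := by ring

theorem integrableOn_radialIntegrand_and_hasSum {a : ℝ} (b z : ℂ) {ρ : ℝ} (hρ : 0 ≤ ρ)
    (hint : IntegrableOn (fun r : ℝ => Real.exp (‖z‖ * r ^ (-a)) * r ^ (-b.re) * Real.exp (-r))
      (Ioi ρ)) :
    IntegrableOn (radialIntegrand a b z) (Ioi ρ) ∧
      HasSum (fun k => ∫ r in Ioi ρ, radialTerm a b z k r)
        (∫ r in Ioi ρ, radialIntegrand a b z r) :=
  integrableOn_and_hasSum_integral_of_norm_le _ hρ (continuousOn_radialTerm a b z)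
    (fun k _ hr => norm_radialTerm_le a b z k hr) hint (fun _ hr => hasSum_radialTerm a b z hr)

theorem integral_radialTerm (a : ℝ) (b z : ℂ) (k : ℕ) (ρ : ℝ) :
    ∫ r in Ioi ρ, radialTerm a b z k r =
      z ^ k / k.factorial * Complex.sin (Real.pi * (a * k + b)) *
        ∫ r in Ioi ρ, (r : ℂ) ^ (-((a : ℂ) * k + b)) * Complex.exp (-(r : ℂ)) :=
  integral_const_mul _ _

/-- Below the abscissa `1` the Hankel contour shrinks to the ray. -/
theorem integral_radialTerm_Ioi_zero {a : ℝ} {b : ℂ} (z : ℂ) {k : ℕ}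
    (h : ((a : ℂ) * k + b).re < 1) :
    1 / (Real.pi : ℂ) * ∫ r in Ioi (0 : ℝ), radialTerm a b z k r = wrightTerm a b z k := by
  rw [integral_radialTerm, integral_cpow_mul_exp_neg_of_re h, wrightTerm, ← div_div,
    div_eq_mul_inv _ (Complex.Gamma _), inv_Gamma_eq_sin_mul_Gamma _ h]
  ring

theorem hasSum_wrightTerm_of_re_lt_one {a : ℝ} (ha : -1 < a) (ha0 : a < 0) {b : ℂ}
    (hb : b.re < 1) (z : ℂ) :
    IntegrableOn (radialIntegrand a b z) (Ioi 0) ∧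
      HasSum (wrightTerm a b z) (radialIntegral a b z 0) := by
  have h := integrableOn_radialIntegrand_and_hasSum (a := a) b z le_rfl
    (integrableOn_Ioi_zero_exp_rpow_mul_rpow_mul_exp_neg (by linarith) (by linarith)
      (norm_nonneg z) (by linarith))
  refine ⟨h.1, (h.2.mul_left (1 / (Real.pi : ℂ))).congr_fun fun k => ?_⟩
  refine (integral_radialTerm_Ioi_zero z ?_).symm
  have : a * k ≤ 0 := mul_nonpos_of_nonpos_of_nonneg ha0.le k.cast_nonneg
  simp
  linarith

theorem radialTerm_one_zero (a : ℝ) (z : ℂ) (r : ℝ) : radialTerm a 1 z 0 r = 0 := by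
  simp [radialTerm]

/-- For `b = 1` the weight `r ^ (-1)` is not integrable at `0`. Dropping the term `k = 0`, which
vanishes there, gains a factor `r ^ (-a)`, and `-a - 1 > -1` when `a < 0`. -/
theorem norm_radialTerm_succ_le (a : ℝ) (b z : ℂ) (k : ℕ) {r : ℝ} (hr : 0 < r) :
    ‖radialTerm a b z (k + 1) r‖ ≤ Real.exp (Real.pi * |b.im|) * ‖z‖ *
      ((‖z‖ * r ^ (-a)) ^ k / k.factorial * (r ^ (-a - b.re) * Real.exp (-r))) := by
  refine (norm_radialTerm_le a b z (k + 1) hr).trans ?_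
  have h1 : ((k.factorial : ℕ) : ℝ) ≤ ((k + 1).factorial : ℕ) :=
    mod_cast Nat.factorial_le k.le_succ
  have h0 : (0 : ℝ) < k.factorial := mod_cast k.factorial_pos
  rw [sub_eq_add_neg, Real.rpow_add hr, pow_succ]
  calc _ ≤ Real.exp (Real.pi * |b.im|) * ((‖z‖ * r ^ (-a)) ^ k * (‖z‖ * r ^ (-a)) / k.factorial *
      (r ^ (-b.re) * Real.exp (-r))) := by gcongr
    _ = _ := by ring

theorem hasSum_wrightTerm_one {a : ℝ} (ha : -1 < a) (ha0 : a < 0) (z : ℂ) :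
    IntegrableOn (radialIntegrand a 1 z) (Ioi 0) ∧
      HasSum (wrightTerm a 1 z) (radialIntegral a 1 z 0 + 1) := by
  have h := integrableOn_and_hasSum_integral_of_norm_le _ le_rfl
    (fun k => continuousOn_radialTerm a 1 z (k + 1))
    (fun k r hr => norm_radialTerm_succ_le a 1 z k hr)
    (integrableOn_Ioi_zero_exp_rpow_mul_rpow_mul_exp_neg (by linarith) (by linarith)
      (norm_nonneg z) (by simp; linarith))
    (f := radialIntegrand a 1 z) (fun r hr => by
      have := (hasSum_nat_add_iff' 1).2 (hasSum_radialTerm a 1 z hr)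
      simpa [radialTerm_one_zero] using this)
  refine ⟨h.1, ?_⟩
  -- The ray misses exactly this term: its sine is `0` while `1 / Γ(1) = 1`.
  have h0 : wrightTerm a 1 z 0 = 1 := by simp [wrightTerm]
  rw [← hasSum_nat_add_iff' 1, Finset.sum_range_one, h0, add_sub_cancel_right]
  refine (h.2.mul_left (1 / (Real.pi : ℂ))).congr_fun fun k => ?_
  refine (integral_radialTerm_Ioi_zero z ?_).symm
  have : a * ((k + 1 : ℕ) : ℝ) < 0 := mul_neg_of_neg_of_pos ha0 (by positivity)
  rw [Complex.add_re, Complex.one_re, Complex.re_ofReal_mul, Complex.natCast_re]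
  linarith

/-! ### Termwise integration over the circle. -/

/-- The `k`-th term of the expansion of the integrand over the circle in powers of `z`. -/
noncomputable def arcTerm (a : ℝ) (b z : ℂ) (ρ : ℝ) (k : ℕ) (φ : ℝ) : ℂ :=
  z ^ k / k.factorial * ((ρ : ℂ) ^ (1 - ((a : ℂ) * k + b)) *
    Complex.exp (ρ * Complex.exp (φ * Complex.I) + (1 - (a * k + b)) * (φ * Complex.I)))

/-- The integrand over the circle in exponential form. -/
noncomputable def arcExp (a : ℝ) (b z : ℂ) (ρ φ : ℝ) : ℂ :=
  Complex.exp (ρ * Complex.exp (φ * Complex.I) +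
    z / ((ρ ^ a : ℝ) : ℂ) * Complex.exp (-(a * φ * Complex.I)) + (1 - b) * (φ * Complex.I))

theorem arcTerm_eq (a : ℝ) (b z : ℂ) {ρ : ℝ} (hρ : 0 < ρ) (k : ℕ) (φ : ℝ) :
    arcTerm a b z ρ k φ = (ρ : ℂ) ^ (1 - b) *
      ((z / ((ρ ^ a : ℝ) : ℂ) * Complex.exp (-(a * φ * Complex.I))) ^ k / k.factorial *
        Complex.exp (ρ * Complex.exp (φ * Complex.I) + (1 - b) * (φ * Complex.I))) := by
  have hρ' : (ρ : ℂ) ≠ 0 := by exact_mod_cast hρ.ne'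
  rw [arcTerm, mul_pow, div_pow, ← Complex.exp_nat_mul, sub_eq_add_neg, Complex.cpow_add _ _ hρ',
    cpow_neg_mul_add a b k hρ, sub_eq_add_neg 1 b, Complex.cpow_add _ _ hρ', Complex.cpow_neg,
    show ρ * Complex.exp (φ * Complex.I) + (1 + -((a : ℂ) * k + b)) * (φ * Complex.I) =
      k * -(a * φ * Complex.I) + (ρ * Complex.exp (φ * Complex.I) + (1 + -b) * (φ * Complex.I))
      by ring, Complex.exp_add (k * -(a * φ * Complex.I))]
  ring

theorem hasSum_arcTerm (a : ℝ) (b z : ℂ) {ρ : ℝ} (hρ : 0 < ρ) (φ : ℝ) :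
    HasSum (fun k => arcTerm a b z ρ k φ) ((ρ : ℂ) ^ (1 - b) * arcExp a b z ρ φ) := by
  simp_rw [arcTerm_eq a b z hρ]
  rw [arcExp, show ∀ x y w : ℂ, x + y + w = y + (x + w) from fun x y w => by ring, Complex.exp_add (_ * _) (_ + _)]
  exact ((Complex.hasSum_pow_div_factorial _).mul_right _).mul_left _

theorem norm_arcTerm_le (a : ℝ) (b z : ℂ) {ρ : ℝ} (hρ : 0 < ρ) (k : ℕ) {φ : ℝ}
    (hφ : |φ| ≤ Real.pi) :
    ‖arcTerm a b z ρ k φ‖ ≤ ‖(ρ : ℂ) ^ (1 - b)‖ *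
      (‖z / ((ρ ^ a : ℝ) : ℂ)‖ ^ k / k.factorial * Real.exp (ρ + ‖1 - b‖ * Real.pi)) := by
  have h1 : ‖Complex.exp (-(a * φ * Complex.I))‖ = 1 := by
    rw [show -((a : ℂ) * φ * Complex.I) = ((-(a * φ) : ℝ) : ℂ) * Complex.I by push_cast; ring,
      Complex.norm_exp_ofReal_mul_I]
  have h2 : ‖Complex.exp (ρ * Complex.exp (φ * Complex.I) + (1 - b) * (φ * Complex.I))‖ ≤
      Real.exp (ρ + ‖1 - b‖ * Real.pi) := by
    rw [Complex.norm_exp, Real.exp_le_exp]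
    refine (Complex.re_le_norm _).trans ((norm_add_le _ _).trans ?_)
    rw [norm_mul, norm_mul, norm_mul, Complex.norm_exp_ofReal_mul_I, Complex.norm_I, mul_one,
      mul_one, Complex.norm_real, Complex.norm_real, Real.norm_of_nonneg hρ.le, Real.norm_eq_abs]
    gcongr
  rw [arcTerm_eq a b z hρ, norm_mul, norm_mul, norm_div, norm_pow, norm_mul, h1, mul_one,
    Complex.norm_natCast]
  gcongr

theorem hasSum_integral_arcTerm (a : ℝ) (b z : ℂ) {ρ : ℝ} (hρ : 0 < ρ) :
    HasSum (fun k => ∫ φ in (-Real.pi)..Real.pi, arcTerm a b z ρ k φ)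
      ((ρ : ℂ) ^ (1 - b) * ∫ φ in (-Real.pi)..Real.pi, arcExp a b z ρ φ) := by
  rw [← intervalIntegral.integral_const_mul]
  have hb := ((hasSum_pow_div_factorial ‖z / ((ρ ^ a : ℝ) : ℂ)‖).mul_right
    (Real.exp (ρ + ‖1 - b‖ * Real.pi))).mul_left ‖(ρ : ℂ) ^ (1 - b)‖
  refine intervalIntegral.hasSum_integral_of_dominated_convergence (fun k _ =>
    ‖(ρ : ℂ) ^ (1 - b)‖ *
      (‖z / ((ρ ^ a : ℝ) : ℂ)‖ ^ k / k.factorial * Real.exp (ρ + ‖1 - b‖ * Real.pi)))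
    (fun k => ?_) (fun k => Eventually.of_forall fun φ hφ => ?_)
    (Eventually.of_forall fun φ _ => hb.summable) intervalIntegrable_const
    (Eventually.of_forall fun φ _ => hasSum_arcTerm a b z hρ φ)
  · refine Continuous.aestronglyMeasurable ?_
    unfold arcTerm
    fun_prop
  · rw [uIoc_of_le (by linarith [Real.pi_pos])] at hφ
    exact norm_arcTerm_le a b z hρ k (abs_le.2 ⟨hφ.1.le, hφ.2⟩)

theorem integral_arcTerm (a : ℝ) (b z : ℂ) (ρ : ℝ) (k : ℕ) :
    ∫ φ in (-Real.pi)..Real.pi, arcTerm a b z ρ k φ =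
      z ^ k / k.factorial * ((ρ : ℂ) ^ (1 - ((a : ℂ) * k + b)) * hankelArc ρ (a * k + b)) := by
  simp only [arcTerm, intervalIntegral.integral_const_mul, hankelArc]

/-- The cosine form is the even part in `φ` of the exponential form, hence has the same integral
over `[-π, π]`. -/
theorem arcIntegrand_eq (a : ℝ) (b z : ℂ) (ρ φ : ℝ) :
    arcIntegrand a b z ρ φ = (arcExp a b z ρ φ + arcExp a b z ρ (-φ)) / 2 := by
  have e : ∀ t : ℝ, arcExp a b z ρ t =
      Complex.exp (((ρ * Real.cos t : ℝ) : ℂ) + (Real.cos (a * t) : ℂ) * z / ((ρ ^ a : ℝ) : ℂ)) *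
      Complex.exp ((((ρ * Real.sin t : ℝ) : ℂ)
      - z * (Real.sin (a * t) : ℂ) / ((ρ ^ a : ℝ) : ℂ) + (1 - b) * (t : ℂ)) * Complex.I) := by
    intro t
    rw [arcExp, ← Complex.exp_add, ← neg_mul, Complex.exp_mul_I, Complex.exp_mul_I, Complex.cos_neg,
      Complex.sin_neg]
    congr 1
    push_cast
    ring
  rw [e, e, arcIntegrand, Complex.cos]
  simp only [mul_neg, Real.cos_neg, Real.sin_neg]
  push_cast
  have h : ∀ u v : ℂ, -u - z * -v / ((ρ ^ a : ℝ) : ℂ) + (1 - b) * -(φ : ℂ) =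
    -(u - z * v / ((ρ ^ a : ℝ) : ℂ) + (1 - b) * φ) := fun u v => by ring
  rw [h]
  ring

theorem continuous_arcExp (a : ℝ) (b z : ℂ) (ρ : ℝ) : Continuous (arcExp a b z ρ) := by
  unfold arcExp
  fun_prop

theorem intervalIntegrable_arcIntegrand (a : ℝ) (b z : ℂ) (ρ x y : ℝ) :
    IntervalIntegrable (arcIntegrand a b z ρ) volume x y := by
  refine Continuous.intervalIntegrable ?_ _ _
  unfold arcIntegrand
  fun_prop

theorem integral_arcIntegrand (a : ℝ) (b z : ℂ) (ρ : ℝ) :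
    ∫ φ in (-Real.pi)..Real.pi, arcIntegrand a b z ρ φ =
      ∫ φ in (-Real.pi)..Real.pi, arcExp a b z ρ φ := by
  have hc := continuous_arcExp a b z ρ
  have h := intervalIntegral.integral_comp_neg (a := -Real.pi) (b := Real.pi) (arcExp a b z ρ)
  rw [neg_neg] at h
  simp_rw [arcIntegrand_eq]
  rw [intervalIntegral.integral_div, intervalIntegral.integral_add
    (hc.intervalIntegrable _ _) (Continuous.intervalIntegrable (by fun_prop) _ _), h]
  ring

/-! ### Summation of the series and the substitution `u = r ^ a`. -/

/-- The Wright series summed through Hankel's formula with an arbitrary radius. -/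
theorem hasSum_wrightTerm {a : ℝ} (ha : -1 < a) (b z : ℂ) {ρ : ℝ} (hρ : 0 < ρ) :
    IntegrableOn (radialIntegrand a b z) (Ioi ρ) ∧
      HasSum (wrightTerm a b z) (radialIntegral a b z ρ + arcIntegral a b z ρ) := by
  have h := integrableOn_radialIntegrand_and_hasSum (a := a) b z hρ.le
    (integrableOn_exp_rpow_mul_rpow_mul_exp_neg (by linarith) _ _ hρ)
  refine ⟨h.1, ?_⟩
  have h2 := (hasSum_integral_arcTerm a b z hρ).mul_left (1 / (2 * (Real.pi : ℂ)))
  convert! (h.2.mul_left (1 / (Real.pi : ℂ))).add h2 using 1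
  · funext k
    rw [integral_radialTerm, integral_arcTerm, wrightTerm, ← div_div,
      div_eq_mul_inv _ (Complex.Gamma _), ← hankel_eq_inv_Gamma hρ, hankel]
    ring
  · rw [radialIntegral, arcIntegral, integral_arcIntegrand]
    ring

theorem rpow_smul_substIntegrand {a : ℝ} (ha : 0 < a) (b z : ℂ) {r : ℝ} (hr : 0 < r) :
    (a * r ^ (a - 1)) • substIntegrand a b z (r ^ a) = a * radialIntegrand a b z r := by
  have hr' : (r : ℂ) ≠ 0 := by exact_mod_cast hr.ne'
  have ha' : (a : ℂ) ≠ 0 := by exact_mod_cast ha.ne'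
  have h1 : (r ^ a) ^ (1 / a) = r := by
    rw [← Real.rpow_mul hr.le, mul_one_div_cancel ha.ne', Real.rpow_one]
  have h2 : ((r ^ a : ℝ) : ℂ) ^ ((1 - b) / (a : ℂ) - 1) = (r : ℂ) ^ (1 - b - a) := by
    -- With `r = exp (log r)` all powers become exponentials of real multiples of the exponent, so
    -- no branch condition arises.
    rw [← Real.exp_log hr, ← Real.exp_mul]
    have hp : ∀ (x : ℝ) (w : ℂ), ((Real.exp x : ℝ) : ℂ) ^ w = Complex.exp (x * w) := by
      intro x w
      rw [Complex.cpow_def_of_ne_zero (by exact_mod_cast (Real.exp_pos x).ne'),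
        ← Complex.ofReal_log (Real.exp_pos x).le, Real.log_exp]
    rw [hp, hp]
    congr 1
    push_cast
    field_simp
  have h3 : ((r ^ (a - 1) : ℝ) : ℂ) * (r : ℂ) ^ (1 - b - a) = ((r : ℂ) ^ b)⁻¹ := by
    rw [Complex.ofReal_cpow hr.le, ← Complex.cpow_add _ _ hr', ← Complex.cpow_neg]
    congr 1
    push_cast
    ring
  rw [Complex.real_smul, substIntegrand, radialIntegrand, h1, h2, Complex.ofReal_mul,
    div_eq_mul_inv _ ((r : ℂ) ^ b), ← h3]
  ring

theorem image_rpow_Ioi {a : ℝ} (ha : 0 < a) {ρ : ℝ} (hρ : 0 ≤ ρ) :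
    (fun r : ℝ => r ^ a) '' Ioi ρ = Ioi (ρ ^ a) :=
  (Real.continuous_rpow_const ha.le).continuousOn.image_Ioi_of_strictMonoOn
    ((Real.strictMonoOn_rpow_Ici_of_exponent_pos ha).mono (Ici_subset_Ici.2 hρ))
    (tendsto_rpow_atTop ha)

theorem integrableOn_substIntegrand {a : ℝ} (ha : 0 < a) {b z : ℂ} {ρ : ℝ} (hρ : 0 < ρ)
    (h : IntegrableOn (radialIntegrand a b z) (Ioi ρ)) :
    IntegrableOn (substIntegrand a b z) (Ioi (ρ ^ a)) := by
  rw [← image_rpow_Ioi ha hρ.le, integrableOn_image_iff_integrableOn_abs_deriv_smul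
    measurableSet_Ioi (fun r hr => (Real.hasDerivAt_rpow_const
      (Or.inl (hρ.trans hr).ne')).hasDerivWithinAt)
    ((Real.strictMonoOn_rpow_Ici_of_exponent_pos ha).injOn.mono
      fun r hr => hρ.le.trans (le_of_lt hr))]
  refine IntegrableOn.congr_fun (h.const_mul (a : ℂ)) (fun r hr => ?_) measurableSet_Ioi
  have hr0 : 0 < r := hρ.trans hr
  rw [abs_of_nonneg (by positivity), rpow_smul_substIntegrand ha b z hr0]

theorem substIntegral_eq_radialIntegral {a : ℝ} (ha : 0 < a) (b z : ℂ) {ρ : ℝ} (hρ : 0 < ρ) :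
    substIntegral a b z (ρ ^ a) = radialIntegral a b z ρ := by
  have ha' : (a : ℂ) ≠ 0 := by exact_mod_cast ha.ne'
  have h := integral_comp_rpow_Ioi_of_pos' (g := substIntegrand a b z) ha
    (c := ρ ^ a) (by positivity)
  rw [Real.rpow_rpow_inv hρ.le ha.ne', setIntegral_congr_fun measurableSet_Ioi
    (fun r hr => rpow_smul_substIntegrand ha b z (hρ.trans hr)), integral_const_mul] at h
  rw [substIntegral, radialIntegral, ← h]
  field_simp

theorem wright_zero (b z : ℂ) : wright 0 b z = Complex.exp z / Complex.Gamma b := by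
  refine HasSum.tsum_eq ?_
  convert! (Complex.hasSum_pow_div_factorial z).div_const (Complex.Gamma b) using 1
  funext k
  simp [wrightTerm, div_div]

theorem mainTheorem1 (a : ℝ) (ha : -1 < a) (b z : ℂ) :
    Summable (wrightTerm a b z) ∧
    (a < 0 → b.re < 1 →
      MeasureTheory.IntegrableOn (radialIntegrand a b z) (Set.Ioi 0) ∧
      wright a b z = radialIntegral a b z 0) ∧
    (a < 0 → b = 1 →
      MeasureTheory.IntegrableOn (radialIntegrand a b z) (Set.Ioi 0) ∧
      wright a b z = radialIntegral a b z 0 + 1) ∧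
    (a < 0 → 1 < b.re →
      MeasureTheory.IntegrableOn (radialIntegrand a b z) (Set.Ioi (wrightRadius a z)) ∧
      IntervalIntegrable (arcIntegrand a b z (wrightRadius a z)) MeasureTheory.volume
        (-Real.pi) Real.pi ∧
      wright a b z =
        radialIntegral a b z (wrightRadius a z) + arcIntegral a b z (wrightRadius a z)) ∧
    (a = 0 → wright a b z = Complex.exp z / Complex.Gamma b) ∧
    (0 < a →
      MeasureTheory.IntegrableOn (substIntegrand a b z) (Set.Ioi (wrightRadius a z ^ a)) ∧
      IntervalIntegrable (arcIntegrand a b z (wrightRadius a z)) MeasureTheory.volume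
        (-Real.pi) Real.pi ∧
      wright a b z =
        substIntegral a b z (wrightRadius a z ^ a) + arcIntegral a b z (wrightRadius a z)) := by
  have hε : 0 < wrightRadius a z := lt_max_of_lt_right one_pos
  have h := hasSum_wrightTerm ha b z hε
  refine ⟨h.2.summable, fun ha0 hb => ?_, fun ha0 hb => ?_, fun _ _ => ?_, fun ha0 => ?_,
    fun ha0 => ?_⟩
  · have h1 := hasSum_wrightTerm_of_re_lt_one ha ha0 hb z
    exact ⟨h1.1, h1.2.tsum_eq⟩
  · subst hb
    have h1 := hasSum_wrightTerm_one ha ha0 z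
    exact ⟨h1.1, h1.2.tsum_eq⟩
  · exact ⟨h.1, intervalIntegrable_arcIntegrand _ _ _ _ _ _, h.2.tsum_eq⟩
  · rw [ha0, wright_zero]
  · refine ⟨integrableOn_substIntegrand ha0 hε h.1, intervalIntegrable_arcIntegrand _ _ _ _ _ _, ?_⟩
    rw [substIntegral_eq_radialIntegral ha0 b z hε]
    exact h.2.tsum_eq
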